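/- Let $E$ be a (real or complex) Banach space and let $D$ be the infinitesimal generator of a strongly continuous one-parameter group of bounded operators $e^{tD}$, $t\in\mathbb{R}$, in $E$ which is bounded, i.e. $\sup_{t\in\mathbb{R}}\|e^{tD}\|<\infty$ (for example, a group of isometries). For $\sigma>0$ let $\mathbf{B}_\sigma(D)$ be the set of all $f\in E$ that belong to the domain of $D^k$ and satisfy $\|D^kf\|\le\sigma^k\|f\|$ for every $k\in\mathbb{N}$. Put $\operatorname{sinc}(x)=\frac{\sin \pi x}{\pi x}$ for $x\neq 0$ and $\operatorname{sinc}(0)=1$. If $f\in\mathbf{B}_\sigma(D)$, then for every $t\in\mathbb{R}$ $$e^{tD}f=f+t\,\operatorname{sinc}\!\left(\frac{\sigma t}{\pi}\right)Df+t\sum_{k\in\mathbb{Z}\setminus\{0\}}\frac{e^{\frac{k\pi}{\sigma}D}f-f}{\frac{k\pi}{\sigma}}\,\operatorname{sinc}\!\left(\frac{\sigma t}{\pi}-k\right)$$ and $$f=e^{tD}f-t\,\operatorname{sinc}\!\left(\frac{\sigma t}{\pi}\right)e^{tD}Df-t\sum_{k\in\mathbb{Z}\setminus\{0\}}\frac{e^{\left(\frac{k\pi}{\sigma}+t\right)D}f-e^{tD}f}{\frac{k\pi}{\sigma}}\,\operatorname{sinc}\!\left(\frac{\sigma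 t}{\pi}+k\right),$$ where both series converge (unconditionally) in the norm of $E$. -/

import Mathlib

open Filter Topology

noncomputable section

/-- Normalized cardinal sine, `sin (π x) / (π x)` for `x ≠ 0`, with value `1` at `0`. -/
def cardinalSine (x : ℝ) : ℝ := Real.sinc (Real.pi * x)

section UnboundedOperators

variable {R E F G : Type*} [Ring R] [AddCommGroup E] [Module R E] [AddCommGroup F] [Module R F]
  [AddCommGroup G] [Module R G]

/-- Composition of partially defined operators, on its natural domain
`{x ∈ dom f | f x ∈ dom g}`. -/
def pmapComp (g : F →ₗ.[R] G) (f : E →ₗ.[R] F) : E →ₗ.[R] G where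
  domain :=
    { carrier := {x | ∃ h : x ∈ f.domain, f ⟨x, h⟩ ∈ g.domain}
      zero_mem' := by
        refine ⟨f.domain.zero_mem, ?_⟩
        have h0 : f ⟨0, f.domain.zero_mem⟩ = 0 := f.map_zero
        rw [h0]
        exact g.domain.zero_mem
      add_mem' := by
        rintro x y ⟨hx, hx'⟩ ⟨hy, hy'⟩
        refine ⟨f.domain.add_mem hx hy, ?_⟩
        have h := f.map_add ⟨x, hx⟩ ⟨y, hy⟩
        have h' : f ⟨x + y, f.domain.add_mem hx hy⟩ = f ⟨x, hx⟩ + f ⟨y, hy⟩ := h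
        rw [h']
        exact g.domain.add_mem hx' hy'
      smul_mem' := by
        rintro c x ⟨hx, hx'⟩
        refine ⟨f.domain.smul_mem c hx, ?_⟩
        have h' : f ⟨c • x, f.domain.smul_mem c hx⟩ = c • f ⟨x, hx⟩ := f.map_smul c ⟨x, hx⟩
        rw [h']
        exact g.domain.smul_mem c hx' }
  toFun :=
    { toFun := fun x => g ⟨f ⟨x.1, x.2.1⟩, x.2.2⟩
      map_add' := by
        rintro ⟨x, hx, hx'⟩ ⟨y, hy, hy'⟩
        rw [← g.map_add]
        congr 1
        exact Subtype.ext (f.map_add ⟨x, hx⟩ ⟨y, hy⟩)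
      map_smul' := by
        rintro c ⟨x, hx, hx'⟩
        rw [RingHom.id_apply, ← g.map_smul]
        congr 1
        exact Subtype.ext (f.map_smul c ⟨x, hx⟩) }

/-- The powers `D ^ k` of a partially defined operator, on their natural domains:
`D ^ 0` is the identity of the whole space and `D ^ (k + 1) = D ∘ D ^ k`. -/
def pmapPow (D : E →ₗ.[R] E) : ℕ → (E →ₗ.[R] E)
  | 0 => (LinearMap.id : E →ₗ[R] E).toPMap ⊤
  | k + 1 => pmapComp D (pmapPow D k)

theorem mem_domain_pmapPow_one {D : E →ₗ.[R] E} {f : E} (hf : f ∈ (pmapPow D 1).domain) :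
    f ∈ D.domain :=
  hf.2

end UnboundedOperators

section Groups

/-- A strongly continuous one-parameter group of bounded operators in `E`. -/
structure StronglyContinuousGroup (𝕜 E : Type*) [RCLike 𝕜] [NormedAddCommGroup E]
    [NormedSpace 𝕜 E] where
  /-- the operators of the group -/
  op : ℝ → E →L[𝕜] E
  op_zero : op 0 = ContinuousLinearMap.id 𝕜 E
  op_add : ∀ s t : ℝ, op (s + t) = (op s).comp (op t)
  continuous_op : ∀ x : E, Continuous fun t : ℝ => op t x

variable {𝕜 E : Type*} [RCLike 𝕜] [NormedAddCommGroup E] [NormedSpace 𝕜 E]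

namespace StronglyContinuousGroup

/-- The difference quotient `(T(h) x - x) / h`. -/
def diffQuot (T : StronglyContinuousGroup 𝕜 E) (x : E) (h : ℝ) : E :=
  ((h : ℝ) : 𝕜)⁻¹ • (T.op h x - x)

theorem tendsto_diffQuot_add (T : StronglyContinuousGroup 𝕜 E) {x y u v : E}
    (hx : Tendsto (T.diffQuot x) (𝓝[≠] 0) (𝓝 u)) (hy : Tendsto (T.diffQuot y) (𝓝[≠] 0) (𝓝 v)) :
    Tendsto (T.diffQuot (x + y)) (𝓝[≠] 0) (𝓝 (u + v)) := by
  refine (hx.add hy).congr fun h => ?_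
  simp only [diffQuot, map_add, ← smul_add]
  congr 1
  abel

theorem tendsto_diffQuot_smul (T : StronglyContinuousGroup 𝕜 E) (c : 𝕜) {x u : E}
    (hx : Tendsto (T.diffQuot x) (𝓝[≠] 0) (𝓝 u)) :
    Tendsto (T.diffQuot (c • x)) (𝓝[≠] 0) (𝓝 (c • u)) := by
  refine (hx.const_smul c).congr fun h => ?_
  simp only [diffQuot, map_smul, ← smul_sub]
  rw [smul_comm]

/-- The infinitesimal generator: `D x = lim_{h → 0} (T(h) x - x) / h`, whose domain is the set of
all `x` for which the limit exists in the norm of `E`. -/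
def generator (T : StronglyContinuousGroup 𝕜 E) : E →ₗ.[𝕜] E where
  domain :=
    { carrier := {x | ∃ y, Tendsto (T.diffQuot x) (𝓝[≠] 0) (𝓝 y)}
      zero_mem' := ⟨0, tendsto_const_nhds.congr fun h => by simp [diffQuot]⟩
      add_mem' := fun ⟨u, hu⟩ ⟨v, hv⟩ => ⟨u + v, T.tendsto_diffQuot_add hu hv⟩
      smul_mem' := fun c _ ⟨u, hu⟩ => ⟨c • u, T.tendsto_diffQuot_smul c hu⟩ }
  toFun :=
    { toFun := fun x => x.2.choose
      map_add' := fun x y => tendsto_nhds_unique (x + y).2.choose_spec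
        (T.tendsto_diffQuot_add x.2.choose_spec y.2.choose_spec)
      map_smul' := fun c x => tendsto_nhds_unique (c • x).2.choose_spec
        (T.tendsto_diffQuot_smul c x.2.choose_spec) }

theorem tendsto_generator (T : StronglyContinuousGroup 𝕜 E) (x : T.generator.domain) :
    Tendsto (T.diffQuot x) (𝓝[≠] 0) (𝓝 (T.generator x)) :=
  x.2.choose_spec

/-- The group is bounded: `sup_t ‖T(t)‖ < ∞`. -/
def IsBounded (T : StronglyContinuousGroup 𝕜 E) : Prop :=
  ∃ M : ℝ, ∀ t : ℝ, ‖T.op t‖ ≤ M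

end StronglyContinuousGroup

/-- The Bernstein space `B_σ(D)`: all vectors `f` in the domain of every power of `D` such that
`‖D ^ k f‖ ≤ σ ^ k ‖f‖` for all `k`. -/
def bernsteinSpace (D : E →ₗ.[𝕜] E) (σ : ℝ) : Set E :=
  {f | ∀ k : ℕ, ∃ h : f ∈ (pmapPow D k).domain, ‖pmapPow D k ⟨f, h⟩‖ ≤ σ ^ k * ‖f‖}

theorem mem_domain_of_mem_bernsteinSpace {D : E →ₗ.[𝕜] E} {σ : ℝ} {f : E}
    (hf : f ∈ bernsteinSpace D σ) : f ∈ D.domain :=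
  mem_domain_pmapPow_one (hf 1).1

end Groups

end

/-!
The orbit `s ↦ T(s) f` of a vector `f` of the Bernstein space has the derivatives `s ↦ T(s) D ^ k f`
(`StronglyContinuousGroup.hasDerivAt_op_apply`), which are bounded by `M ‖f‖ σ ^ k` on the whole
line, and the asserted formula is a sampling formula for such functions
(`sampling_formula_of_norm_deriv_le`). After a rescaling `σ = π`, and after applying continuous
real functionals, the function is scalar. Its Taylor series has the same sum whatever the real base
point, so it extends to an entire function `P` with `|P(z)| ≤ C e^{π |Im z|}`
(`exists_entire_extension`), and `g(z) = (P(z) - P(0)) / z` is entire and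
`O(e^{π |Im z|} / (1 + |z|))`.

For such `g` the classical sampling theorem `g(z) = ∑ g(k) sinc (z - k)` holds
(`hasSum_mul_complexCardinalSine`): the difference of the two sides is entire and vanishes at the
integers, so it equals `Q(z) sin π z` with `Q` entire. Since `|sin π z| ≥ e^{π |Im z|} / 8` at
distance at least `1 / 2` from the integers (`exp_le_norm_sin_pi_mul`), `Q` is bounded there, hence
everywhere by the maximum principle, hence constant by Liouville's theorem; and `Q(iy) → 0` as
`y → ∞`, so `Q = 0`.
In the resulting expansion of `P(x) = P(0) + x g(x)` the term `k = 0` gives `P'(0) = φ(D f)`.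
-/

/-! ### Entire functions: quotients and the sine -/

/-- An entire function vanishing at the zeros of `s`, all simple, is divisible by `s`: near a zero
the quotient is the quotient of the two divided differences. -/
theorem exists_entire_quotient_of_simple_zeros {R s : ℂ → ℂ} (hR : Differentiable ℂ R)
    (hs : Differentiable ℂ s) (hzero : ∀ z, s z = 0 → R z = 0)
    (hsimple : ∀ z, s z = 0 → deriv s z ≠ 0) :
    ∃ Q : ℂ → ℂ, Differentiable ℂ Q ∧ ∀ z, R z = Q z * s z := by
  classical
  refine ⟨fun z => if s z = 0 then deriv R z / deriv s z else R z / s z, fun z => ?_, fun z => ?_⟩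
  · by_cases hz : s z = 0
    · have hRd : Differentiable ℂ (dslope R z) := by
        rw [← differentiableOn_univ] at hR ⊢
        exact (Complex.differentiableOn_dslope univ_mem).2 hR
      have hsd : Differentiable ℂ (dslope s z) := by
        rw [← differentiableOn_univ] at hs ⊢
        exact (Complex.differentiableOn_dslope univ_mem).2 hs
      have hne : dslope s z z ≠ 0 := by rw [dslope_same]; exact hsimple z hz
      refine ((hRd z).div (hsd z) hne).congr_of_eventuallyEq ?_
      filter_upwards [(hsd z).continuousAt.eventually_ne hne] with w hw
      rcases eq_or_ne w z with rfl | hwz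
      · simp [hz]
      · have h0 : w - z ≠ 0 := sub_ne_zero.2 hwz
        rw [dslope_of_ne _ hwz, slope_def_field, hz, sub_zero] at hw
        have hsw : s w ≠ 0 := fun h => hw (by rw [h, zero_div])
        rw [if_neg hsw, Pi.div_apply, dslope_of_ne _ hwz, dslope_of_ne _ hwz, slope_def_field,
          slope_def_field, hz, hzero z hz, sub_zero, sub_zero, div_div_div_cancel_right₀ h0]
    · refine ((hR z).div (hs z) hz).congr_of_eventuallyEq ?_
      filter_upwards [(hs z).continuousAt.eventually_ne hz] with w hw
      simp [hw]
  · by_cases hz : s z = 0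
    · simp [hz, hzero z hz]
    · simp [hz]

theorem Complex.norm_sin_le_exp_abs_im (z : ℂ) : ‖Complex.sin z‖ ≤ Real.exp |z.im| := by
  have h1 : ‖Complex.exp (-z * Complex.I)‖ ≤ Real.exp |z.im| := by
    rw [Complex.norm_exp]
    exact Real.exp_le_exp.2 (by simpa using le_abs_self z.im)
  have h2 : ‖Complex.exp (z * Complex.I)‖ ≤ Real.exp |z.im| := by
    rw [Complex.norm_exp]
    exact Real.exp_le_exp.2 (by simpa using neg_le_abs z.im)
  have h3 := norm_sub_le (Complex.exp (-z * Complex.I)) (Complex.exp (z * Complex.I))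
  rw [Complex.sin, norm_div, norm_mul, Complex.norm_I, mul_one, Complex.norm_ofNat]
  linarith

theorem Complex.sinh_abs_im_le_norm_sin (z : ℂ) : Real.sinh |z.im| ≤ ‖Complex.sin z‖ := by
  have h1 : ‖Complex.exp (-z * Complex.I)‖ = Real.exp z.im := by
    rw [Complex.norm_exp]; simp
  have h2 : ‖Complex.exp (z * Complex.I)‖ = Real.exp (-z.im) := by
    rw [Complex.norm_exp]; simp
  have h3 := abs_norm_sub_norm_le (Complex.exp (-z * Complex.I)) (Complex.exp (z * Complex.I))
  rw [h1, h2] at h3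
  rw [Complex.sin, norm_div, norm_mul, Complex.norm_I, mul_one, Complex.norm_ofNat,
    ← Real.abs_sinh, Real.sinh_eq, abs_div, abs_two]
  linarith

theorem Complex.abs_sin_re_le_norm_sin (z : ℂ) : |Real.sin z.re| ≤ ‖Complex.sin z‖ := by
  have h : (Complex.sin z).re = Real.sin z.re * Real.cosh z.im := by
    rw [Complex.sin_eq z]
    norm_cast
    simp [Complex.sin_ofReal_re, Complex.cosh_ofReal_re]
  calc |Real.sin z.re| ≤ |Real.sin z.re| * Real.cosh z.im :=
        le_mul_of_one_le_right (abs_nonneg _) (Real.one_le_cosh _)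
    _ = |(Complex.sin z).re| := by rw [h, abs_mul, abs_of_pos (Real.cosh_pos z.im)]
    _ ≤ _ := Complex.abs_re_le_norm _

theorem exp_le_norm_sin_pi_mul {z : ℂ} (hz : ∀ k : ℤ, 1 / 2 ≤ ‖z - k‖) :
    Real.exp (Real.pi * |z.im|) / 8 ≤ ‖Complex.sin (Real.pi * z)‖ := by
  have him : |((Real.pi : ℂ) * z).im| = Real.pi * |z.im| := by
    simp [abs_mul, abs_of_pos Real.pi_pos]
  have hre : ((Real.pi : ℂ) * z).re = Real.pi * z.re := by simp
  rcases le_total (1 / 4) |z.im| with h | h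
  · have h1 := Complex.sinh_abs_im_le_norm_sin (Real.pi * z)
    rw [him] at h1
    refine le_trans ?_ h1
    have h2 : Real.exp (-(Real.pi * |z.im|)) ≤ Real.exp (Real.pi * |z.im|) / 2 := by
      have h3 : (1 : ℝ) ≤ 2 * (Real.pi * |z.im|) := by nlinarith [Real.pi_gt_three]
      have h4 : 2 * Real.exp (-(Real.pi * |z.im|)) ≤ Real.exp (Real.pi * |z.im|) :=
        calc 2 * Real.exp (-(Real.pi * |z.im|))
            ≤ Real.exp (2 * (Real.pi * |z.im|)) * Real.exp (-(Real.pi * |z.im|)) := by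
              gcongr
              linarith [Real.add_one_le_exp (2 * (Real.pi * |z.im|))]
          _ = _ := by rw [← Real.exp_add]; congr 1; ring
      linarith
    rw [Real.sinh_eq]
    linarith [Real.exp_pos (Real.pi * |z.im|)]
  · -- In the strip `|Im z| ≤ 1 / 4`, `Re z` stays at distance at least `2 / 5` from the integers.
    have h1 := Complex.abs_sin_re_le_norm_sin (Real.pi * z)
    rw [hre] at h1
    refine le_trans ?_ h1
    set n := round z.re with hn
    have h2 : |z.re - n| ≤ 1 / 2 := abs_sub_round z.re
    have h3 : (1 / 2 : ℝ) ^ 2 ≤ (z.re - n) ^ 2 + z.im ^ 2 := by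
      have := pow_le_pow_left₀ (by norm_num) (hz n) 2
      rw [Complex.sq_norm, Complex.normSq_apply] at this
      simp only [Complex.sub_re, Complex.intCast_re, Complex.sub_im, Complex.intCast_im,
        sub_zero] at this
      linarith [sq (z.re - n), sq z.im]
    have h4 : z.im ^ 2 ≤ (1 / 4) ^ 2 := sq_le_sq' (by linarith [neg_abs_le z.im])
      (by linarith [le_abs_self z.im])
    have h5 : 2 / 5 ≤ |z.re - n| := by
      refine abs_le_of_sq_le_sq' ?_ (abs_nonneg _) |>.2
      rw [sq_abs]; linarith
    have h6 : 2 * |z.re - n| ≤ |Real.sin (Real.pi * z.re)| := by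
      have h7 := Real.mul_abs_le_abs_sin (x := Real.pi * z.re - n * Real.pi) (by
        rw [show Real.pi * z.re - n * Real.pi = Real.pi * (z.re - n) by ring, abs_mul,
          abs_of_pos Real.pi_pos]
        nlinarith [Real.pi_pos])
      rw [Real.sin_sub_int_mul_pi, abs_mul, abs_zpow, abs_neg, abs_one, one_zpow, one_mul,
        show Real.pi * z.re - n * Real.pi = Real.pi * (z.re - n) by ring, abs_mul,
        abs_of_pos Real.pi_pos] at h7
      refine le_trans (le_of_eq ?_) h7
      field_simp
    have h8 : Real.exp (Real.pi * |z.im|) ≤ 3 := by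
      refine le_trans (Real.exp_le_exp.2 (?_ : _ ≤ (1 : ℝ))) (by linarith [Real.exp_one_lt_d9])
      nlinarith [Real.pi_le_four, Real.pi_pos]
    linarith

theorem summable_int_inv_one_add_norm_sq :
    Summable fun k : ℤ => ((1 + ‖(k : ℂ)‖) ^ 2)⁻¹ := by
  have h : Summable fun n : ℕ => ((1 + (n : ℝ)) ^ 2)⁻¹ := by
    have := (summable_nat_add_iff 1).2 (Real.summable_one_div_nat_pow.2 one_lt_two)
    refine this.congr fun n => ?_
    push_cast
    rw [one_div, add_comm]
  refine Summable.of_nat_of_neg ?_ ?_ <;> simpa using h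

/-! ### The cardinal sine on the complex plane -/

/-- The entire function `sin (π z) / (π z)`, with value `1` at `0`. -/
noncomputable def complexCardinalSine (z : ℂ) : ℂ :=
  dslope (fun w : ℂ => Complex.sin (Real.pi * w)) 0 z / Real.pi

theorem complexCardinalSine_of_ne {z : ℂ} (hz : z ≠ 0) :
    complexCardinalSine z = Complex.sin (Real.pi * z) / (Real.pi * z) := by
  rw [complexCardinalSine, dslope_of_ne _ hz, slope_def_field]
  simp only [mul_zero, Complex.sin_zero, sub_zero]
  rw [div_div, mul_comm z]

theorem hasDerivAt_sin_pi_mul (z : ℂ) :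
    HasDerivAt (fun w : ℂ => Complex.sin (Real.pi * w))
      (Complex.cos (Real.pi * z) * Real.pi) z := by
  simpa using ((hasDerivAt_id z).const_mul (Real.pi : ℂ)).csin

theorem complexCardinalSine_zero : complexCardinalSine 0 = 1 := by
  rw [complexCardinalSine, dslope_same, (hasDerivAt_sin_pi_mul 0).deriv]
  simp

theorem complexCardinalSine_ofReal (x : ℝ) : complexCardinalSine x = cardinalSine x := by
  rcases eq_or_ne x 0 with rfl | hx
  · simp [complexCardinalSine_zero, cardinalSine]
  · rw [complexCardinalSine_of_ne (by exact_mod_cast hx), cardinalSine,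
      Real.sinc_of_ne_zero (mul_ne_zero Real.pi_ne_zero hx)]
    push_cast
    rfl

theorem differentiable_complexCardinalSine : Differentiable ℂ complexCardinalSine := by
  have h : Differentiable ℂ (dslope (fun w : ℂ => Complex.sin (Real.pi * w)) 0) := by
    rw [← differentiableOn_univ]
    exact (Complex.differentiableOn_dslope univ_mem).2
      fun z _ => (hasDerivAt_sin_pi_mul z).differentiableAt.differentiableWithinAt
  exact h.div_const _

theorem sin_pi_mul_sub_intCast (z : ℂ) (k : ℤ) :
    Complex.sin (Real.pi * (z - k)) = (-1) ^ k * Complex.sin (Real.pi * z) := by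
  rw [← Int.cast_negOnePow, ← Complex.sin_antiperiodic.sub_int_mul_eq]
  congr 1
  ring

theorem complexCardinalSine_intCast_of_ne {k : ℤ} (hk : k ≠ 0) :
    complexCardinalSine k = 0 := by
  rw [complexCardinalSine_of_ne (by exact_mod_cast hk), mul_comm, Complex.sin_int_mul_pi, zero_div]

/-- A continuous function that is `O(e^{π |Im z|} / |z|)` off the unit disc satisfies the same
bound everywhere with `|z|` replaced by `1 + |z|`. -/
theorem exists_le_exp_div_one_add_norm {u : ℂ → ℂ} (hu : Continuous u) {C : ℝ} (hC : 0 ≤ C)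
    (h : ∀ z, 1 ≤ ‖z‖ → ‖u z‖ ≤ C * Real.exp (Real.pi * |z.im|) / ‖z‖) :
    ∃ K : ℝ, 0 ≤ K ∧ ∀ z, ‖u z‖ ≤ K * Real.exp (Real.pi * |z.im|) / (1 + ‖z‖) := by
  obtain ⟨B, hB⟩ := (isCompact_closedBall (0 : ℂ) 1).exists_bound_of_continuousOn hu.continuousOn
  have hB0 : 0 ≤ B := (norm_nonneg _).trans (hB 0 (by simp))
  refine ⟨2 * C + 2 * B, by positivity, fun z => ?_⟩
  have he : 1 ≤ Real.exp (Real.pi * |z.im|) := Real.one_le_exp (by positivity)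
  have hz0 := norm_nonneg z
  rw [le_div_iff₀ (by positivity)]
  rcases le_total 1 ‖z‖ with h1 | h1
  · have h2 := h z h1
    rw [le_div_iff₀ (by positivity)] at h2
    nlinarith [norm_nonneg (u z), mul_nonneg hB0 (zero_le_one.trans he)]
  · have h2 := hB z (by simpa using h1)
    have h3 : ‖u z‖ * (1 + ‖z‖) ≤ B * 2 := by gcongr; linarith
    nlinarith [mul_nonneg hC (zero_le_one.trans he)]

theorem exists_norm_complexCardinalSine_le :
    ∃ K : ℝ, 0 ≤ K ∧ ∀ z, ‖complexCardinalSine z‖ ≤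
      K * Real.exp (Real.pi * |z.im|) / (1 + ‖z‖) := by
  refine exists_le_exp_div_one_add_norm differentiable_complexCardinalSine.continuous
    zero_le_one fun z hz => ?_
  have hz0 : z ≠ 0 := norm_pos_iff.1 (by linarith)
  rw [complexCardinalSine_of_ne hz0, norm_div, norm_mul, Complex.norm_real,
    Real.norm_of_nonneg Real.pi_pos.le, one_mul]
  have h1 := Complex.norm_sin_le_exp_abs_im (Real.pi * z)
  rw [show |((Real.pi : ℂ) * z).im| = Real.pi * |z.im| by
    simp [abs_mul, abs_of_pos Real.pi_pos]] at h1
  gcongr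
  nlinarith [Real.pi_gt_three]

/-! ### The sampling theorem -/

theorem exists_norm_complexCardinalSine_sub_intCast_le :
    ∃ L : ℝ, 0 ≤ L ∧ ∀ (z : ℂ) (k : ℤ), ‖complexCardinalSine (z - k)‖ ≤
      L * Real.exp (Real.pi * |z.im|) * (1 + ‖z‖) * (1 + ‖(k : ℂ)‖)⁻¹ := by
  obtain ⟨L, hL0, hL⟩ := exists_norm_complexCardinalSine_le
  refine ⟨L, hL0, fun z k => (hL (z - k)).trans ?_⟩
  simp only [Complex.sub_im, Complex.intCast_im, sub_zero]
  have hz := norm_nonneg z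
  have hk := norm_nonneg (k : ℂ)
  have hzk := norm_nonneg (z - k)
  rw [div_eq_mul_inv, mul_assoc _ (1 + ‖z‖)]
  gcongr
  rw [← div_eq_mul_inv, inv_le_comm₀ (by positivity) (by positivity), inv_div,
    div_le_iff₀ (by positivity)]
  have := norm_sub_norm_le (k : ℂ) z
  rw [norm_sub_rev] at this
  nlinarith

theorem sin_pi_mul_eq_zero_iff {z : ℂ} :
    Complex.sin (Real.pi * z) = 0 ↔ ∃ n : ℤ, z = n := by
  rw [Complex.sin_eq_zero_iff]
  have hpi : (Real.pi : ℂ) ≠ 0 := by exact_mod_cast Real.pi_ne_zero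
  refine exists_congr fun n => ⟨fun h => mul_left_cancel₀ hpi (h.trans (mul_comm _ _)), ?_⟩
  rintro rfl
  exact mul_comm _ _

theorem half_le_norm_sub_intCast_of_mem_sphere {z : ℂ} {n : ℤ}
    (hz : z ∈ Metric.sphere (n : ℂ) (1 / 2)) (k : ℤ) : 1 / 2 ≤ ‖z - k‖ := by
  rw [mem_sphere_iff_norm] at hz
  rcases eq_or_ne n k with rfl | hne
  · exact hz.ge
  · have h1 : (1 : ℝ) ≤ ‖(n : ℂ) - k‖ := by
      rw [← Int.cast_sub, Complex.norm_intCast]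
      exact_mod_cast Int.one_le_abs (sub_ne_zero.2 hne)
    have h2 := norm_sub_le (z - k) (z - n)
    rw [sub_sub_sub_cancel_left] at h2
    linarith

/-- A bound for an entire function that holds at distance at least `1 / 2` from the integers holds
everywhere, by the maximum principle on the discs of radius `1 / 2` around the integers. -/
theorem norm_le_of_forall_half_le_norm_sub_intCast {Q : ℂ → ℂ} (hQ : Differentiable ℂ Q) {B : ℝ}
    (hB : ∀ z : ℂ, (∀ k : ℤ, 1 / 2 ≤ ‖z - k‖) → ‖Q z‖ ≤ B) (z : ℂ) : ‖Q z‖ ≤ B := by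
  by_cases hz : ∀ k : ℤ, 1 / 2 ≤ ‖z - k‖
  · exact hB z hz
  · push Not at hz
    obtain ⟨n, hn⟩ := hz
    refine Complex.norm_le_of_forall_mem_frontier_norm_le (U := Metric.ball (n : ℂ) (1 / 2))
      Metric.isBounded_ball hQ.diffContOnCl (fun w hw => ?_)
      (subset_closure (mem_ball_iff_norm.2 hn))
    rw [frontier_ball _ (by norm_num)] at hw
    exact hB w (half_le_norm_sub_intCast_of_mem_sphere hw)

theorem inv_norm_sub_intCast_le {z : ℂ} (hz : ∀ k : ℤ, 1 / 2 ≤ ‖z - k‖) (k : ℤ) :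
    ‖z - k‖⁻¹ ≤ 4 * (1 + ‖((k - round z.re : ℤ) : ℂ)‖)⁻¹ := by
  have h0 := hz k
  have hn := norm_nonneg ((k - round z.re : ℤ) : ℂ)
  rw [← div_eq_mul_inv, inv_le_comm₀ (by linarith) (by positivity), inv_div,
    div_le_iff₀ (by norm_num)]
  rw [Complex.norm_intCast]
  have h1 : |z.re - k| ≤ ‖z - k‖ := by
    simpa using Complex.abs_re_le_norm (z - k)
  have h2 : |((k - round z.re : ℤ) : ℝ)| ≤ |z.re - k| + 1 / 2 := by
    have h3 := abs_sub_round z.re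
    have h4 := abs_sub (z.re - round z.re) (z.re - k)
    rw [sub_sub_sub_cancel_left] at h4
    push_cast
    linarith
  rcases eq_or_ne (k - round z.re) 0 with h | h
  · rw [h]; simp; linarith
  · have h5 : (1 : ℝ) ≤ |((k - round z.re : ℤ) : ℝ)| := by exact_mod_cast Int.one_le_abs h
    linarith

/-- **Sampling theorem** of Whittaker, Kotelnikov and Shannon, for entire functions of exponential
type at most `π` that decay like `1 / |z|` on horizontal lines. The difference `R` of the two sides
vanishes on `ℤ`, so `R = Q sin (π ·)` with `Q` entire; `Q` is bounded at distance at least `1 / 2`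
from the integers, hence everywhere, hence constant, and it tends to zero along the imaginary
axis. -/
theorem hasSum_mul_complexCardinalSine {g : ℂ → ℂ} (hgd : Differentiable ℂ g) {K : ℝ}
    (hg : ∀ z, ‖g z‖ ≤ K * Real.exp (Real.pi * |z.im|) / (1 + ‖z‖)) (z : ℂ) :
    HasSum (fun k : ℤ => g k * complexCardinalSine (z - k)) (g z) := by
  obtain ⟨L, hL0, hL⟩ := exists_norm_complexCardinalSine_sub_intCast_le
  have hK : 0 ≤ K := by
    have := (norm_nonneg _).trans (hg 0)
    simpa using this
  have hpi : (Real.pi : ℂ) ≠ 0 := by exact_mod_cast Real.pi_ne_zero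
  have hw := summable_int_inv_one_add_norm_sq
  have hgk : ∀ k : ℤ, ‖g k‖ ≤ K * (1 + ‖(k : ℂ)‖)⁻¹ := fun k => by
    have h1 := hg k
    simpa [div_eq_mul_inv] using h1
  have hterm : ∀ (z : ℂ) (k : ℤ), ‖g k * complexCardinalSine (z - k)‖ ≤
      K * L * Real.exp (Real.pi * |z.im|) * (1 + ‖z‖) * ((1 + ‖(k : ℂ)‖) ^ 2)⁻¹ := fun z k =>
    calc ‖g k * complexCardinalSine (z - k)‖
        ≤ K * (1 + ‖(k : ℂ)‖)⁻¹ *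
            (L * Real.exp (Real.pi * |z.im|) * (1 + ‖z‖) * (1 + ‖(k : ℂ)‖)⁻¹) := by
          rw [norm_mul]
          gcongr
          exacts [hgk k, hL z k]
      _ = _ := by rw [← inv_pow]; ring
  have hsum : ∀ z, Summable fun k : ℤ => g k * complexCardinalSine (z - k) := fun z =>
    Summable.of_norm_bounded (hw.mul_left _) (hterm z)
  have hSd : Differentiable ℂ fun z => ∑' k : ℤ, g k * complexCardinalSine (z - k) := by
    intro z
    set r := ‖z‖ + 1
    have hd : DifferentiableOn ℂ (fun z => ∑' k : ℤ, g k * complexCardinalSine (z - k))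
        (Metric.ball 0 r) := by
      refine Complex.differentiableOn_tsum_of_summable_norm
        (u := fun k : ℤ => K * L * Real.exp (Real.pi * r) * (1 + r) * ((1 + ‖(k : ℂ)‖) ^ 2)⁻¹)
        (hw.mul_left _) (fun k => ?_) Metric.isOpen_ball fun k w hwr => ?_
      · exact ((differentiable_complexCardinalSine.comp
          (differentiable_id.sub_const _)).const_mul _).differentiableOn
      · have h1 : ‖w‖ ≤ r := (mem_ball_zero_iff.1 hwr).le
        have h2 := Complex.abs_im_le_norm w
        refine (hterm w k).trans ?_
        gcongr
        exact h2.trans h1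
    exact hd.differentiableAt (Metric.isOpen_ball.mem_nhds (by simp [r]))
  set R : ℂ → ℂ := fun z => g z - ∑' k : ℤ, g k * complexCardinalSine (z - k) with hR
  have hRd : Differentiable ℂ R := hgd.sub hSd
  have hRint : ∀ n : ℤ, R n = 0 := fun n => by
    have h1 : ∑' k : ℤ, g k * complexCardinalSine (n - k) = g n := by
      rw [tsum_eq_single n fun k hk => ?_]
      · simp [complexCardinalSine_zero]
      · rw [← Int.cast_sub, complexCardinalSine_intCast_of_ne (sub_ne_zero.2 hk.symm), mul_zero]
    simp [hR, h1]
  obtain ⟨Q, hQd, hQ⟩ := exists_entire_quotient_of_simple_zeros hRd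
    (s := fun w => Complex.sin (Real.pi * w))
    (fun z => (hasDerivAt_sin_pi_mul z).differentiableAt)
    (fun z hz => by obtain ⟨n, rfl⟩ := sin_pi_mul_eq_zero_iff.1 hz; exact hRint n)
    (fun z hz => by
      rw [(hasDerivAt_sin_pi_mul z).deriv]
      refine mul_ne_zero (fun hc => ?_) hpi
      have := Complex.sin_sq_add_cos_sq (Real.pi * z)
      rw [hc, show Complex.sin (Real.pi * z) = 0 from hz] at this
      simp at this)
  -- Off the integers, `Q = g / sin (π ·) - ∑ k, A · k`.
  set A : ℂ → ℤ → ℂ := fun z k => g k * (-1) ^ k / (Real.pi * (z - k)) with hA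
  have hAk : ∀ z k, ‖A z k‖ ≤ K * (1 + ‖(k : ℂ)‖)⁻¹ * ‖z - k‖⁻¹ := fun z k => by
    have h1 : ‖A z k‖ = ‖g k‖ * (Real.pi⁻¹ * ‖z - k‖⁻¹) := by
      simp [hA, div_eq_mul_inv, abs_of_pos Real.pi_pos, mul_comm]
    rw [h1]
    have h2 : Real.pi⁻¹ ≤ 1 := inv_le_one_of_one_le₀ (by linarith [Real.pi_gt_three])
    calc ‖g k‖ * (Real.pi⁻¹ * ‖z - k‖⁻¹) ≤ K * (1 + ‖(k : ℂ)‖)⁻¹ * (1 * ‖z - k‖⁻¹) := by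
          gcongr; exact hgk k
      _ = _ := by rw [one_mul]
  have hQA : ∀ z : ℂ, (∀ k : ℤ, 1 / 2 ≤ ‖z - k‖) →
      ‖Q z‖ ≤ 8 * K * (1 + ‖z‖)⁻¹ + ‖∑' k, A z k‖ := fun z hz => by
    have h1 := exp_le_norm_sin_pi_mul hz
    have he := Real.exp_pos (Real.pi * |z.im|)
    have hs : Complex.sin (Real.pi * z) ≠ 0 := norm_pos_iff.1 (by linarith)
    have h2 : ∑' k : ℤ, g k * complexCardinalSine (z - k) =
        (∑' k, A z k) * Complex.sin (Real.pi * z) := by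
      rw [← tsum_mul_right]
      refine tsum_congr fun k => ?_
      have h3 : z - k ≠ 0 := norm_pos_iff.1 (by linarith [hz k])
      rw [complexCardinalSine_of_ne h3, sin_pi_mul_sub_intCast]
      simp only [hA]
      ring
    have h4 : Q z = g z / Complex.sin (Real.pi * z) - ∑' k, A z k := by
      rw [eq_sub_iff_add_eq, eq_div_iff hs, add_mul, ← hQ, ← h2]
      simp [hR]
    rw [h4]
    refine (norm_sub_le _ _).trans (add_le_add_left ?_ _)
    rw [norm_div, div_le_iff₀ (by linarith)]
    calc ‖g z‖ ≤ K * Real.exp (Real.pi * |z.im|) / (1 + ‖z‖) := hg z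
      _ = 8 * K * (1 + ‖z‖)⁻¹ * (Real.exp (Real.pi * |z.im|) / 8) := by field_simp
      _ ≤ _ := by gcongr
  -- The products `(1 + |k|)⁻¹ |z - k|⁻¹` are summable uniformly in `z`, by `ab ≤ a² + b²` and the
  -- invariance of the sum under the shift of `k` by the integer nearest to `Re z`.
  obtain ⟨B, hB⟩ : ∃ B, ∀ z : ℂ, (∀ k : ℤ, 1 / 2 ≤ ‖z - k‖) → ‖Q z‖ ≤ B := by
    refine ⟨8 * K * 1 + (K * (∑' k : ℤ, ((1 + ‖(k : ℂ)‖) ^ 2)⁻¹) +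
      16 * K * ∑' k : ℤ, ((1 + ‖(k : ℂ)‖) ^ 2)⁻¹), fun z hz => (hQA z hz).trans ?_⟩
    have hz0 := norm_nonneg z
    refine add_le_add ?_ ?_
    · gcongr
      exact inv_le_one_of_one_le₀ (by linarith)
    · have hshift : HasSum (fun k : ℤ => ((1 + ‖((k - round z.re : ℤ) : ℂ)‖) ^ 2)⁻¹)
          (∑' k : ℤ, ((1 + ‖(k : ℂ)‖) ^ 2)⁻¹) :=
        (Equiv.subRight (round z.re)).hasSum_iff.2 hw.hasSum
      refine tsum_of_norm_bounded ((hw.hasSum.mul_left K).add (hshift.mul_left (16 * K)))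
        fun k => (hAk z k).trans ?_
      have h1 := inv_norm_sub_intCast_le hz k
      set a := (1 + ‖(k : ℂ)‖)⁻¹ with ha
      set b := (1 + ‖((k - round z.re : ℤ) : ℂ)‖)⁻¹ with hb
      have ha0 : 0 ≤ a := by positivity
      rw [← inv_pow, ← inv_pow, ← ha, ← hb]
      calc K * a * ‖z - k‖⁻¹ ≤ K * a * (4 * b) := by gcongr
        _ ≤ K * a ^ 2 + 16 * K * b ^ 2 := by
          nlinarith [mul_nonneg hK (sq_nonneg (a - 2 * b)), mul_nonneg hK (sq_nonneg b)]
  have hQbdd := norm_le_of_forall_half_le_norm_sub_intCast hQd hB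
  have hQconst : ∀ z w, Q z = Q w := fun z w =>
    hQd.apply_eq_apply_of_bounded
      (isBounded_iff_forall_norm_le.2 ⟨B, by rintro _ ⟨z, rfl⟩; exact hQbdd z⟩) z w
  -- Dominated convergence: `|iy - k| ≥ (1 + |k|) / 2` for `y ≥ 1`.
  have hQlim : Tendsto (fun y : ℝ => Q (y * Complex.I)) atTop (𝓝 0) := by
    have hre : ∀ (y : ℝ) (k : ℤ), |(k : ℝ)| ≤ ‖(y * Complex.I - k : ℂ)‖ := fun y k => by
      simpa using Complex.abs_re_le_norm (y * Complex.I - k)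
    have him : ∀ (y : ℝ) (k : ℤ), |y| ≤ ‖(y * Complex.I - k : ℂ)‖ := fun y k => by
      simpa using Complex.abs_im_le_norm (y * Complex.I - k)
    have h1 : Tendsto (fun y : ℝ => ∑' k, A (y * Complex.I) k) atTop (𝓝 (∑' _ : ℤ, (0 : ℂ))) := by
      refine tendsto_tsum_of_dominated_convergence
        (bound := fun k : ℤ => 2 * K * ((1 + ‖(k : ℂ)‖) ^ 2)⁻¹) (hw.mul_left _) (fun k => ?_) ?_
      · refine squeeze_zero_norm' (a := fun y : ℝ => K * (1 + ‖(k : ℂ)‖)⁻¹ * y⁻¹) ?_ ?_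
        · filter_upwards [eventually_ge_atTop 1] with y hy
          refine (hAk _ k).trans ?_
          have h2 := him y k
          rw [abs_of_nonneg (by linarith)] at h2
          gcongr
        · simpa using tendsto_inv_atTop_zero.const_mul (K * (1 + ‖(k : ℂ)‖)⁻¹)
      · filter_upwards [eventually_ge_atTop 1] with y hy k
        refine (hAk _ k).trans ?_
        have h2 := him y k
        have h3 := hre y k
        rw [abs_of_nonneg (by linarith)] at h2
        rw [Complex.norm_intCast]
        have h4 : ‖(y * Complex.I - k : ℂ)‖⁻¹ ≤ 2 * (1 + |(k : ℝ)|)⁻¹ := by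
          have h0 := abs_nonneg (k : ℝ)
          rw [← div_eq_mul_inv, inv_le_comm₀ (by linarith) (by positivity), inv_div]
          linarith
        calc K * (1 + |(k : ℝ)|)⁻¹ * ‖(y * Complex.I - k : ℂ)‖⁻¹
            ≤ K * (1 + |(k : ℝ)|)⁻¹ * (2 * (1 + |(k : ℝ)|)⁻¹) := by gcongr
          _ = _ := by rw [← inv_pow]; ring
    rw [tsum_zero] at h1
    refine squeeze_zero_norm' (a := fun y : ℝ => 8 * K * (1 + y)⁻¹ + ‖∑' k, A (y * Complex.I) k‖)
      ?_ ?_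
    · filter_upwards [eventually_ge_atTop 1] with y hy
      have h2 := hQA (y * Complex.I) fun k => by
        have := him y k
        rw [abs_of_nonneg (by linarith)] at this
        linarith
      simpa [abs_of_nonneg (zero_le_one.trans hy)] using h2
    · have h2 : Tendsto (fun y : ℝ => 8 * K * (1 + y)⁻¹) atTop (𝓝 0) := by
        simpa using (tendsto_inv_atTop_zero.comp
          (tendsto_atTop_add_const_left _ (1 : ℝ) tendsto_id)).const_mul (8 * K)
      simpa using h2.add h1.norm
  have hQ0 : ∀ z, Q z = 0 := fun z =>
    tendsto_nhds_unique (tendsto_const_nhds.congr fun y : ℝ => hQconst z (y * Complex.I)) hQlim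
  have h1 : g z - ∑' k : ℤ, g k * complexCardinalSine (z - k) = 0 := by
    simpa [hQ0] using hQ z
  rw [sub_eq_zero.1 h1]
  exact (hsum z).hasSum

/-! ### Entire extension of functions with geometrically bounded derivatives -/

/-- As the base point `s` moves, the derivatives of the terms of the Taylor polynomial at `z`
telescope. -/
theorem hasDerivAt_sum_taylor {F : ℕ → ℝ → ℂ} (hF : ∀ k s, HasDerivAt (F k) (F (k + 1) s) s)
    (z : ℂ) (n : ℕ) (s : ℝ) :
    HasDerivAt (fun s : ℝ => ∑ k ∈ Finset.range (n + 1), F k s * ((z - s) ^ k / k.factorial))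
      (F (n + 1) s * ((z - s) ^ n / n.factorial)) s := by
  induction n with
  | zero => simpa using hF 0 s
  | succ n ih =>
    have h1 : HasDerivAt (fun s : ℝ => z - s) (-1) s := by
      simpa using (hasDerivAt_id s).ofReal_comp.const_sub z
    have h2 := (hF (n + 1) s).mul ((h1.pow (n + 1)).div_const ((n + 1).factorial : ℂ))
    simp only [Finset.sum_range_succ _ (n + 1)]
    refine (ih.add h2).congr_deriv ?_
    have h3 : (n.factorial : ℂ) ≠ 0 := by exact_mod_cast n.factorial_ne_zero
    have h4 : (n + 1 : ℂ) ≠ 0 := by exact_mod_cast n.succ_ne_zero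
    simp only [Nat.factorial_succ, Nat.cast_mul, Nat.cast_add, Nat.cast_one, Nat.add_sub_cancel,
      Pi.pow_apply]
    field_simp
    ring

theorem norm_mul_pow_div_factorial_le {c w : ℂ} {C a r : ℝ} {k : ℕ} (hc : ‖c‖ ≤ C * a ^ k)
    (hw : ‖w‖ ≤ r) : ‖c * (w ^ k / k.factorial)‖ ≤ C * ((a * r) ^ k / k.factorial) := by
  rw [norm_mul, norm_div, norm_pow, Complex.norm_natCast]
  calc ‖c‖ * (‖w‖ ^ k / k.factorial) ≤ C * a ^ k * (r ^ k / k.factorial) := by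
        gcongr
        exact (norm_nonneg _).trans hc
    _ = _ := by rw [mul_pow]; ring

/-- The value at `z` of the Taylor series of `F 0` does not depend on the real base point `x`: as a
function of `x` its partial sums have derivatives tending to zero. -/
theorem hasSum_taylor_of_norm_deriv_le {F : ℕ → ℝ → ℂ}
    (hF : ∀ k s, HasDerivAt (F k) (F (k + 1) s) s) {C a : ℝ}
    (hbd : ∀ k s, ‖F k s‖ ≤ C * a ^ k) (z : ℂ) (x : ℝ) :
    HasSum (fun k : ℕ => F k x * ((z - x) ^ k / k.factorial))
      (∑' k : ℕ, F k 0 * (z ^ k / k.factorial)) := by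
  have hsum : ∀ x : ℝ, Summable fun k : ℕ => F k x * ((z - x) ^ k / k.factorial) := fun x =>
    Summable.of_norm_bounded ((Real.summable_pow_div_factorial (a * ‖z - x‖)).mul_left C)
      fun k => norm_mul_pow_div_factorial_le (hbd k x) le_rfl
  set S : ℕ → ℝ → ℂ := fun n s => ∑ k ∈ Finset.range (n + 1), F k s * ((z - s) ^ k / k.factorial)
    with hS
  have hlim : ∀ x : ℝ, Tendsto (fun n => S n x) atTop
      (𝓝 (∑' k : ℕ, F k x * ((z - x) ^ k / k.factorial))) := fun x =>
    (hsum x).hasSum.tendsto_sum_nat.comp (tendsto_add_atTop_nat 1)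
  have hdiff : Tendsto (fun n => S n x - S n 0) atTop (𝓝 0) := by
    set r := ‖z‖ + |x|
    refine squeeze_zero_norm
      (a := fun n => C * a * ((a * r) ^ n / n.factorial) * ‖x - 0‖) (fun n => ?_) ?_
    · refine (convex_closedBall (0 : ℝ) |x|).norm_image_sub_le_of_norm_hasDerivWithin_le
        (fun s _ => (hasDerivAt_sum_taylor hF z n s).hasDerivWithinAt) (fun s hs => ?_)
        (Metric.mem_closedBall_self (abs_nonneg x)) (by simp)
      have hs' : |s| ≤ |x| := by simpa using hs
      refine norm_mul_pow_div_factorial_le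
        ((hbd (n + 1) s).trans_eq (by rw [pow_succ]; ring)) ?_
      refine (norm_sub_le _ _).trans ?_
      rw [Complex.norm_real, Real.norm_eq_abs]
      simp only [r]
      gcongr
    · simpa using ((FloorSemiring.tendsto_pow_div_factorial_atTop (a * r)).const_mul
        (C * a)).mul_const ‖x - 0‖
  have h0 : (∑' k : ℕ, F k x * ((z - x) ^ k / k.factorial)) =
      ∑' k : ℕ, F k 0 * (z ^ k / k.factorial) := by
    have h1 := tendsto_nhds_unique ((hlim x).sub (hlim 0)) hdiff
    simpa [sub_eq_zero] using h1
  exact h0 ▸ (hsum x).hasSum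

/-- A function on the line whose `k`-th derivative is bounded by `C a ^ k` is the restriction of an
entire function bounded by `C e^{a |Im z|}`: expand it at the point `Re z`. -/
theorem exists_entire_extension {F : ℕ → ℝ → ℂ}
    (hF : ∀ k s, HasDerivAt (F k) (F (k + 1) s) s) {C a : ℝ}
    (hbd : ∀ k s, ‖F k s‖ ≤ C * a ^ k) :
    ∃ P : ℂ → ℂ, Differentiable ℂ P ∧ (∀ x : ℝ, P x = F 0 x) ∧
      ∀ z, ‖P z‖ ≤ C * Real.exp (a * |z.im|) := by
  have hC : 0 ≤ C := by simpa using (norm_nonneg _).trans (hbd 0 0)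
  refine ⟨fun z => ∑' k : ℕ, F k 0 * (z ^ k / k.factorial), fun z => ?_, fun x => ?_, fun z => ?_⟩
  · have hd : DifferentiableOn ℂ (fun z : ℂ => ∑' k : ℕ, F k 0 * (z ^ k / k.factorial))
        (Metric.ball 0 (‖z‖ + 1)) := by
      refine Complex.differentiableOn_tsum_of_summable_norm
        ((Real.summable_pow_div_factorial (a * (‖z‖ + 1))).mul_left C) (fun k => ?_)
        Metric.isOpen_ball fun k w hw =>
          norm_mul_pow_div_factorial_le (hbd k 0) (mem_ball_zero_iff.1 hw).le
      exact (((differentiable_id.pow k).div_const _).const_mul _).differentiableOn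
    exact hd.differentiableAt (Metric.isOpen_ball.mem_nhds (by simp))
  · refine (hasSum_taylor_of_norm_deriv_le hF hbd x x).unique ?_
    convert hasSum_single 0 fun k hk => ?_ using 1
    · simp
    · simp [hk]
  · beta_reduce
    rw [← (hasSum_taylor_of_norm_deriv_le hF hbd z z.re).tsum_eq]
    have h1 : z - z.re = z.im * Complex.I := by
      rw [sub_eq_iff_eq_add, add_comm, Complex.re_add_im]
    have h2 : HasSum (fun k : ℕ => C * ((a * |z.im|) ^ k / k.factorial))
        (C * Real.exp (a * |z.im|)) := by
      rw [Real.exp_eq_exp_ℝ]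
      exact (NormedSpace.expSeries_div_hasSum_exp (a * |z.im|)).mul_left C
    refine tsum_of_norm_bounded h2 fun k => norm_mul_pow_div_factorial_le (hbd k z.re) ?_
    simp [h1]

/-! ### The sampling formula for functions on the line -/

/-- The entire function `g` extends the difference quotient of `F 0` at the origin and is recovered
from its values at the integers. -/
theorem exists_entire_slope {F : ℕ → ℝ → ℂ}
    (hF : ∀ k s, HasDerivAt (F k) (F (k + 1) s) s) {C : ℝ}
    (hbd : ∀ k s, ‖F k s‖ ≤ C * Real.pi ^ k) :
    ∃ g : ℂ → ℂ, (∀ z, HasSum (fun k : ℤ => g k * complexCardinalSine (z - k)) (g z)) ∧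
      g 0 = F 1 0 ∧ ∀ x : ℝ, x * g x = F 0 x - F 0 0 := by
  have hC : 0 ≤ C := by simpa using (norm_nonneg _).trans (hbd 0 0)
  obtain ⟨P, hPd, hPF, hPb⟩ := exists_entire_extension hF hbd
  have hgd : Differentiable ℂ (dslope P 0) := by
    rw [← differentiableOn_univ] at hPd ⊢
    exact (Complex.differentiableOn_dslope univ_mem).2 hPd
  have hP0 : P 0 = F 0 0 := by simpa using hPF 0
  obtain ⟨K, -, hK⟩ := exists_le_exp_div_one_add_norm hgd.continuous (C := 2 * C) (by positivity)
    fun z hz => by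
      have hz0 : z ≠ 0 := norm_pos_iff.1 (by linarith)
      rw [dslope_of_ne _ hz0, slope_def_field, sub_zero, norm_div]
      gcongr
      have h0 : ‖P 0‖ ≤ C := by simpa using hPb 0
      have h1 : 1 ≤ Real.exp (Real.pi * |z.im|) :=
        Real.one_le_exp (mul_nonneg Real.pi_pos.le (abs_nonneg _))
      nlinarith [norm_sub_le (P z) (P 0), hPb z]
  refine ⟨dslope P 0, hasSum_mul_complexCardinalSine hgd hK, ?_, fun x => ?_⟩
  · rw [dslope_same]
    have h1 : HasDerivAt (fun x : ℝ => P x) (deriv P 0) 0 := by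
      have := (hPd 0).hasDerivAt
      rw [← Complex.ofReal_zero] at this
      simpa using this.comp_ofReal
    simp only [hPF] at h1
    exact h1.unique (hF 0 0)
  · have := sub_smul_dslope P 0 (x : ℂ)
    rwa [sub_zero, smul_eq_mul, hPF, hP0] at this

section Banach

variable {E : Type*} [NormedAddCommGroup E] [NormedSpace ℝ E] [CompleteSpace E]

/-- Sampling formula for a function on the line whose `k`-th derivative is bounded by `C π ^ k`. The
series converges absolutely, so that equality can be tested on continuous functionals. -/
theorem sampling_formula_of_norm_deriv_le_pi_pow {F : ℕ → ℝ → E}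
    (hF : ∀ k s, HasDerivAt (F k) (F (k + 1) s) s) {C : ℝ}
    (hbd : ∀ k s, ‖F k s‖ ≤ C * Real.pi ^ k) (x : ℝ) :
    Summable (fun k : {k : ℤ // k ≠ 0} =>
        cardinalSine (x - (k : ℤ)) • (((k : ℤ) : ℝ)⁻¹ • (F 0 (k : ℤ) - F 0 0))) ∧
      F 0 x = F 0 0 + (x * cardinalSine x) • F 1 0 +
        x • ∑' k : {k : ℤ // k ≠ 0},
          cardinalSine (x - (k : ℤ)) • (((k : ℤ) : ℝ)⁻¹ • (F 0 (k : ℤ) - F 0 0)) := by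
  have hC : 0 ≤ C := by simpa using (norm_nonneg _).trans (hbd 0 0)
  obtain ⟨L, hL0, hL⟩ := exists_norm_complexCardinalSine_sub_intCast_le
  set q : ℤ → E := fun k => if k = 0 then F 1 0 else (k : ℝ)⁻¹ • (F 0 k - F 0 0) with hq
  have hq0 : q 0 = F 1 0 := by simp [hq]
  have hqk : ∀ k : {k : ℤ // k ≠ 0}, q k = ((k : ℤ) : ℝ)⁻¹ • (F 0 (k : ℤ) - F 0 0) := fun k => by
    simp [hq, k.2]
  have hqb : ∀ k, ‖q k‖ ≤ 4 * C * (1 + ‖(k : ℂ)‖)⁻¹ := fun k => by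
    rcases eq_or_ne k 0 with rfl | hk
    · rw [hq0]
      have := hbd 1 0
      simp only [pow_one] at this
      simp only [Int.cast_zero, norm_zero, add_zero, inv_one, mul_one]
      nlinarith [Real.pi_le_four]
    · have h1 : (1 : ℝ) ≤ |(k : ℝ)| := by exact_mod_cast Int.one_le_abs hk
      have h2 : ‖F 0 k - F 0 0‖ ≤ 2 * C := by
        have h3 := hbd 0 k
        have h4 := hbd 0 0
        simp only [pow_zero, mul_one] at h3 h4
        linarith [norm_sub_le (F 0 k) (F 0 0)]
      rw [hqk ⟨k, hk⟩, norm_smul, norm_inv, Real.norm_eq_abs, Complex.norm_intCast]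
      calc |(k : ℝ)|⁻¹ * ‖F 0 k - F 0 0‖ ≤ (2 * (1 + |(k : ℝ)|)⁻¹) * (2 * C) := by
            gcongr
            rw [← div_eq_mul_inv, inv_le_comm₀ (by linarith) (by positivity), inv_div]
            linarith
        _ = _ := by ring
  have hsum : Summable fun k : ℤ => cardinalSine (x - k) • q k := by
    refine Summable.of_norm_bounded
      (summable_int_inv_one_add_norm_sq.mul_left (L * (1 + ‖(x : ℂ)‖) * (4 * C))) fun k => ?_
    have h1 := hL x k
    rw [← Complex.ofReal_intCast, ← Complex.ofReal_sub, complexCardinalSine_ofReal,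
      Complex.norm_real] at h1
    simp only [Complex.ofReal_im, abs_zero, mul_zero, Real.exp_zero, mul_one,
      Complex.ofReal_intCast] at h1
    calc ‖cardinalSine (x - k) • q k‖
        ≤ L * (1 + ‖(x : ℂ)‖) * (1 + ‖(k : ℂ)‖)⁻¹ * (4 * C * (1 + ‖(k : ℂ)‖)⁻¹) := by
          rw [norm_smul]
          gcongr
          exact hqb k
      _ = _ := by rw [← inv_pow]; ring
  have hmain : F 0 x - F 0 0 = x • ∑' k : ℤ, cardinalSine (x - k) • q k := by
    refine (SeparatingDual.eq_iff_forall_dual_eq (R := ℝ)).2 fun φ => ?_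
    obtain ⟨g, hg, hg0, hgx⟩ := exists_entire_slope
      (F := fun k s => ((φ (F k s) : ℝ) : ℂ)) (C := ‖φ‖ * C)
      (fun k s => (φ.hasFDerivAt.comp_hasDerivAt s (hF k s)).ofReal_comp) fun k s => by
        rw [Complex.norm_real, mul_assoc]
        exact (φ.le_opNorm _).trans (by gcongr; exact hbd k s)
    have hgk : ∀ k : ℤ, g k = φ (q k) := fun k => by
      rcases eq_or_ne k 0 with rfl | hk
      · simp [hg0, hq0]
      · have hk' : (k : ℂ) ≠ 0 := by exact_mod_cast hk
        have h1 := hgx k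
        rw [Complex.ofReal_intCast, mul_comm, ← eq_div_iff hk'] at h1
        rw [h1, hqk ⟨k, hk⟩, map_smul, map_sub]
        push_cast
        rw [smul_eq_mul]
        push_cast
        rw [div_eq_inv_mul]
    have h2 : HasSum (fun k : ℤ => g k * complexCardinalSine (x - k))
        (φ (∑' k : ℤ, cardinalSine (x - k) • q k) : ℝ) := by
      refine (Complex.hasSum_ofReal.2 (hsum.hasSum.mapL φ)).congr_fun fun k => ?_
      rw [hgk, ← Complex.ofReal_intCast, ← Complex.ofReal_sub, complexCardinalSine_ofReal,
        map_smul, smul_eq_mul, Complex.ofReal_mul, mul_comm]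
    have h3 := hgx x
    rw [(hg x).unique h2] at h3
    rw [map_sub, map_smul, smul_eq_mul]
    exact_mod_cast h3.symm
  have hsplit : cardinalSine x • F 1 0 +
      ∑' k : {k : ℤ // k ≠ 0}, cardinalSine (x - (k : ℤ)) • q k =
        ∑' k : ℤ, cardinalSine (x - k) • q k := by
    have h1 := hsum.tsum_subtype_add_tsum_subtype_compl {0}
    rw [tsum_singleton 0 fun k : ℤ => cardinalSine (x - k) • q k, hq0, Int.cast_zero,
      sub_zero] at h1
    exact h1
  have hfun : (fun k : {k : ℤ // k ≠ 0} => cardinalSine (x - (k : ℤ)) • q k) =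
      fun k : {k : ℤ // k ≠ 0} =>
      cardinalSine (x - (k : ℤ)) • (((k : ℤ) : ℝ)⁻¹ • (F 0 (k : ℤ) - F 0 0)) :=
    funext fun k => by rw [hqk]
  rw [← hfun]
  refine ⟨hsum.subtype {k | k ≠ 0}, ?_⟩
  rw [add_assoc, ← sub_eq_iff_eq_add', hmain, ← hsplit, smul_add, smul_smul]

/-- Sampling formula for a function on the line whose `k`-th derivative is bounded by `C σ ^ k`. -/
theorem sampling_formula_of_norm_deriv_le {F : ℕ → ℝ → E}
    (hF : ∀ k s, HasDerivAt (F k) (F (k + 1) s) s) {C σ : ℝ} (hσ : 0 < σ)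
    (hbd : ∀ k s, ‖F k s‖ ≤ C * σ ^ k) (t : ℝ) :
    Summable (fun k : {k : ℤ // k ≠ 0} =>
        cardinalSine (σ * t / Real.pi - (k : ℤ)) •
          ((((k : ℤ) : ℝ) * Real.pi / σ)⁻¹ • (F 0 (((k : ℤ) : ℝ) * Real.pi / σ) - F 0 0))) ∧
      F 0 t = F 0 0 + (t * cardinalSine (σ * t / Real.pi)) • F 1 0 +
        t • ∑' k : {k : ℤ // k ≠ 0}, cardinalSine (σ * t / Real.pi - (k : ℤ)) •
          ((((k : ℤ) : ℝ) * Real.pi / σ)⁻¹ • (F 0 (((k : ℤ) : ℝ) * Real.pi / σ) - F 0 0)) := by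
  set c := Real.pi / σ with hc
  have hc0 : 0 < c := by positivity
  obtain ⟨h1, h2⟩ := sampling_formula_of_norm_deriv_le_pi_pow
    (F := fun k s => c ^ k • F k (c * s)) (C := C)
    (fun k s => by
      have h3 : HasDerivAt (fun s : ℝ => c * s) c s := by
        simpa using (hasDerivAt_id s).const_mul c
      have h4 := ((hF k (c * s)).scomp s h3).const_smul (c ^ k)
      rw [smul_smul, ← pow_succ] at h4
      exact h4)
    (fun k s => by
      rw [norm_smul, norm_pow, Real.norm_of_nonneg hc0.le]
      calc c ^ k * ‖F k (c * s)‖ ≤ c ^ k * (C * σ ^ k) := by gcongr; exact hbd k _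
        _ = C * (c * σ) ^ k := by rw [mul_pow]; ring
        _ = _ := by rw [hc, div_mul_cancel₀ _ hσ.ne'])
    (σ * t / Real.pi)
  have hct : c * (σ * t / Real.pi) = t := by rw [hc]; field_simp
  simp only [pow_zero, one_smul, mul_zero, pow_one, hct] at h1 h2
  have hterm : (fun k : {k : ℤ // k ≠ 0} => cardinalSine (σ * t / Real.pi - (k : ℤ)) •
      (((k : ℤ) : ℝ)⁻¹ • (F 0 (c * (k : ℤ)) - F 0 0))) = fun k : {k : ℤ // k ≠ 0} =>
      c • (cardinalSine (σ * t / Real.pi - (k : ℤ)) •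
        ((((k : ℤ) : ℝ) * Real.pi / σ)⁻¹ • (F 0 (((k : ℤ) : ℝ) * Real.pi / σ) - F 0 0))) := by
    funext k
    have h3 : ((k : ℤ) : ℝ) * Real.pi / σ = c * (k : ℤ) := by rw [hc]; ring
    rw [h3, smul_comm c, smul_smul c, mul_inv, mul_inv_cancel_left₀ hc0.ne']
  rw [hterm] at h1 h2
  refine ⟨by simpa only [inv_smul_smul₀ hc0.ne'] using h1.const_smul c⁻¹, h2.trans ?_⟩
  rw [tsum_const_smul'', smul_smul, smul_smul, mul_right_comm, mul_comm _ c, hct]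

end Banach

/-! ### Orbits of a one-parameter group -/

namespace StronglyContinuousGroup

variable {𝕜 E : Type*} [RCLike 𝕜] [NormedAddCommGroup E] [NormedSpace 𝕜 E]

theorem hasDerivAt_op_apply [NormedSpace ℝ E] [IsScalarTower ℝ 𝕜 E]
    (T : StronglyContinuousGroup 𝕜 E) (x : T.generator.domain) (s : ℝ) :
    HasDerivAt (fun t => T.op t x) (T.op s (T.generator x)) s := by
  rw [hasDerivAt_iff_tendsto_slope_zero]
  refine (((T.op s).continuous.tendsto _).comp (T.tendsto_generator x)).congr fun h => ?_
  rw [Function.comp_apply, diffQuot, map_smul, map_sub, RCLike.real_smul_eq_coe_smul (K := 𝕜),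
    RCLike.ofReal_inv, T.op_add]
  rfl

end StronglyContinuousGroup

theorem mainTheorem2 {𝕜 E : Type*} [RCLike 𝕜] [NormedAddCommGroup E] [NormedSpace 𝕜 E]
    [CompleteSpace E] (D : E →ₗ.[𝕜] E) (T : StronglyContinuousGroup 𝕜 E)
    (hD : T.generator = D) (hT : T.IsBounded) (σ : ℝ) (hσ : 0 < σ)
    (f : E) (hf : f ∈ bernsteinSpace D σ) (t : ℝ) :
    (Summable (fun k : {k : ℤ // k ≠ 0} =>
        ((cardinalSine (σ * t / Real.pi - (k : ℤ)) : ℝ) : 𝕜) •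
          (((((k : ℤ) : ℝ) * Real.pi / σ : ℝ) : 𝕜)⁻¹ •
            (T.op (((k : ℤ) : ℝ) * Real.pi / σ) f - f))) ∧
      T.op t f = f
        + ((t * cardinalSine (σ * t / Real.pi) : ℝ) : 𝕜) •
            D ⟨f, mem_domain_of_mem_bernsteinSpace hf⟩
        + (t : 𝕜) • ∑' k : {k : ℤ // k ≠ 0},
            ((cardinalSine (σ * t / Real.pi - (k : ℤ)) : ℝ) : 𝕜) •
              (((((k : ℤ) : ℝ) * Real.pi / σ : ℝ) : 𝕜)⁻¹ •
                (T.op (((k : ℤ) : ℝ) * Real.pi / σ) f - f))) ∧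
    (Summable (fun k : {k : ℤ // k ≠ 0} =>
        ((cardinalSine (σ * t / Real.pi + (k : ℤ)) : ℝ) : 𝕜) •
          (((((k : ℤ) : ℝ) * Real.pi / σ : ℝ) : 𝕜)⁻¹ •
            (T.op (((k : ℤ) : ℝ) * Real.pi / σ + t) f - T.op t f))) ∧
      f = T.op t f
        - ((t * cardinalSine (σ * t / Real.pi) : ℝ) : 𝕜) •
            T.op t (D ⟨f, mem_domain_of_mem_bernsteinSpace hf⟩)
        - (t : 𝕜) • ∑' k : {k : ℤ // k ≠ 0},
            ((cardinalSine (σ * t / Real.pi + (k : ℤ)) : ℝ) : 𝕜) •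
              (((((k : ℤ) : ℝ) * Real.pi / σ : ℝ) : 𝕜)⁻¹ •
                (T.op (((k : ℤ) : ℝ) * Real.pi / σ + t) f - T.op t f))) := by
  subst hD
  let _ : NormedSpace ℝ E := NormedSpace.restrictScalars ℝ 𝕜 E
  have : IsScalarTower ℝ 𝕜 E := IsScalarTower.of_algebraMap_smul fun _ _ => rfl
  obtain ⟨M, hM⟩ := hT
  have hMf : ∀ s (x : E), ‖T.op s x‖ ≤ M * ‖x‖ := fun s x =>
    (T.op s).le_of_opNorm_le (hM s) x
  have hpow : ∀ k (h : f ∈ (pmapPow T.generator k).domain)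
      (h' : f ∈ (pmapPow T.generator (k + 1)).domain),
      ∃ hd : pmapPow T.generator k ⟨f, h⟩ ∈ T.generator.domain,
        pmapPow T.generator (k + 1) ⟨f, h'⟩ = T.generator ⟨_, hd⟩ :=
    fun k h h' => ⟨h'.2, rfl⟩
  -- The orbits of the vectors `D ^ k f` are the successive derivatives of the orbit of `f`.
  have key := fun t => sampling_formula_of_norm_deriv_le
    (F := fun k s => T.op s (pmapPow T.generator k ⟨f, (hf k).1⟩)) (C := M * ‖f‖)
    (fun k s => by
      obtain ⟨hd, he⟩ := hpow k (hf k).1 (hf (k + 1)).1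
      rw [he]
      exact T.hasDerivAt_op_apply ⟨_, hd⟩ s) hσ
    (fun k s => by
      have hM0 : 0 ≤ M := (norm_nonneg _).trans (hM 0)
      refine (hMf s _).trans ?_
      rw [mul_assoc, mul_comm ‖f‖]
      exact mul_le_mul_of_nonneg_left (hf k).2 hM0) t
  have h0 : pmapPow T.generator 0 ⟨f, (hf 0).1⟩ = f := rfl
  have h1 : pmapPow T.generator 1 ⟨f, (hf 1).1⟩ =
      T.generator ⟨f, mem_domain_of_mem_bernsteinSpace hf⟩ := rfl
  simp only [h0, h1, T.op_zero, ContinuousLinearMap.id_apply,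
    RCLike.real_smul_eq_coe_smul (K := 𝕜), RCLike.ofReal_inv] at key
  refine ⟨key t, ?_⟩
  -- The second formula is the first one at `-t`, multiplied by `T.op t`; `cardinalSine` is even.
  obtain ⟨h2, h3⟩ := key (-t)
  have hop : ∀ s x, T.op t (T.op s x) = T.op (s + t) x := fun s x => by
    rw [add_comm, T.op_add]; rfl
  have heven : ∀ k : ℤ, cardinalSine (σ * -t / Real.pi - k) = cardinalSine (σ * t / Real.pi + k) :=
    fun k => by
      rw [cardinalSine, cardinalSine, ← Real.sinc_neg]
      congr 1
      ring
  have heven0 : cardinalSine (σ * -t / Real.pi) = cardinalSine (σ * t / Real.pi) := by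
    simpa using heven 0
  simp only [heven] at h2 h3
  refine ⟨by simpa only [Function.comp_def, map_smul, map_sub, hop] using h2.mapL (T.op t), ?_⟩
  have h4 := congrArg (T.op t) h3
  simp only [map_smul, (T.op t).map_tsum h2, map_sub, hop, neg_add_cancel, T.op_zero,
    ContinuousLinearMap.id_apply, heven0, neg_mul, RCLike.ofReal_neg, neg_smul,
    ← sub_eq_add_neg] at h4
  exact h4
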